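/- A $k$-round coin-flipping protocol over $\ell$ players, each sending one bit per round, is a function $\pi:(\{0,1\}^{\ell})^{k}\to\{0,1\}$; the output is $\pi$ applied to the messages sent in rounds $1,\dots,k$, and good players send independent uniform bits. $\Pr[\pi=1]$ is the probability of output $1$ when all players are good. For a set $B\subseteq[\ell]$ of bad players, an adversary strategy chooses, in each round, the bits of the players in $B$ as an arbitrary function of all messages of the earlier rounds and of the bits of the good players in the current round. We say that $B$ can bias $\pi$ to $1$ with probability at least $p$ if some adversary strategy makes the output equal $1$ with probability at least $p$ over the uniform bits of the players outside $B$. Let $\log$ be the binary logarithm, $\log^{(0)}x=x$ and $\log^{(j+1)}x=\log(\log^{(j)}x)$. **Theorem.** There is an absolute constant $C>0$ such that the following holds for all integers $k\ge 1$ and $\ell$ with $\log^{(j)}\ell>0$ for $0\le j\le k$ (that is, $\log^{(k)}\ell$ is defined and positive). For every $k$-round coin-flipping protocol $\pi$ over $\ell$ players, each sending one bit per round, with $\Pr[\pi=1]\ge 0.01$, there is a set $B\subseteq[\ell]$ of bad players with $$|B|\le C\cdot\frac{\ell}{\log^{(k)}\ell}$$ that can bias $\pi$ to $1$ with probability at least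 $0.99$. In particular, for two-round protocols $O(\ell/\log\log\ell)$ bad players suffice. -/

import Mathlib

namespace CoinFlip

/-- The messages of all `ℓ` players in one round: one bit per player. -/
abbrev Message (ℓ : ℕ) : Type := Fin ℓ → Bool

/-- A `k`-round coin-flipping protocol over `ℓ` players, each sending one bit per round: the
output bit is a function of the whole transcript. Honest players send independent uniform bits. -/
abbrev Protocol (k ℓ : ℕ) : Type := (Fin k → Message ℓ) → Bool

/-- The probability that `f ω = 1` when `ω` is uniform on the finite type `Ω`. -/
noncomputable def prOne {Ω : Type*} [Fintype Ω] (f : Ω → Bool) : ℝ :=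
  ((Finset.univ.filter fun ω => f ω = true).card : ℝ) / (Fintype.card Ω : ℝ)

/-- The bits sent by the good players (those outside `B`) in one round. -/
abbrev GoodBits {ℓ : ℕ} (B : Finset (Fin ℓ)) : Type := {j : Fin ℓ // j ∉ B} → Bool

/-- The bits sent by the bad players (those in `B`) in one round. -/
abbrev BadBits {ℓ : ℕ} (B : Finset (Fin ℓ)) : Type := {j : Fin ℓ // j ∈ B} → Bool

/-- A strategy of a computationally unbounded, rushing adversary who controls the players in `B`:
in each round it sees the messages of all players in all earlier rounds (oldest first) and the bits
of all good players in the current round, and then chooses the bits of the bad players. -/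
abbrev Strategy {ℓ : ℕ} (B : Finset (Fin ℓ)) : Type :=
  List (Message ℓ) → GoodBits B → BadBits B

/-- The message of one round, after history `h`, if the good players send `x` and the bad players
follow `σ`. -/
def roundMessage {ℓ : ℕ} {B : Finset (Fin ℓ)} (σ : Strategy B) (h : List (Message ℓ))
    (x : GoodBits B) : Message ℓ :=
  fun j => if hj : j ∈ B then σ h x ⟨j, hj⟩ else x ⟨j, hj⟩

/-- The messages of the next `k` rounds, after history `h`, if the good players send `x i` in the
`i`-th of these rounds and the bad players follow `σ`. -/
def play {ℓ : ℕ} {B : Finset (Fin ℓ)} (σ : Strategy B) :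
    (k : ℕ) → List (Message ℓ) → (Fin k → GoodBits B) → (Fin k → Message ℓ)
  | 0, _, _ => Fin.elim0
  | k + 1, h, x =>
      Fin.cons (roundMessage σ h (x 0))
        (play σ k (h ++ [roundMessage σ h (x 0)]) (Fin.tail x))

/-- The probability, over the uniform bits of the good players, that `π` outputs `1` when the bad
players in `B` follow `σ`. -/
noncomputable def prOneAgainst {k ℓ : ℕ} (π : Protocol k ℓ) (B : Finset (Fin ℓ))
    (σ : Strategy B) : ℝ :=
  prOne fun x : Fin k → GoodBits B => π (play σ k [] x)

/-- The players in `B` can bias `π` so that it outputs `1` with probability at least `p`. -/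
def CanBias {k ℓ : ℕ} (π : Protocol k ℓ) (B : Finset (Fin ℓ)) (p : ℝ) : Prop :=
  ∃ σ : Strategy B, p ≤ prOneAgainst π B σ

/-- The `k`-fold iterated binary logarithm. -/
noncomputable def iterLog (k : ℕ) (x : ℝ) : ℝ := (Real.logb 2)^[k] x

end CoinFlip

/-!
For one round and one function `f` with values in `{0, 1}`, corrupting a further player `i` raises
the expectation of the best forced value (`boost`) by half the influence of `i`. The
Kahn–Kalai–Linial inequality `kkl` gives a dichotomy at expectation `q`: either some player has
influence more than `36⁻ᵐ`, or the total influence exceeds `2 m q (1 - q)`, so that an average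
player raises the logit of `q` by about `m / ℓ`. It rests on hypercontractivity for functions with
values in `{-1, 0, 1}`, `noiseForm_third_sq_le`.

Applied to a whole family of functions, the dichotomy lets rare influential players be
corrupted individually for each function and ordinary players be corrupted for all functions at
once. By `exists_common_and_individual_coalitions`, a common coalition of size `O(T ℓ / m)` and
individual coalitions of size `O(T 36ᵐ)` bias at least half of the functions from `p` to `1 - p`,
where `T = log (1 / p)`.

The family to which this is applied consists of the last round of the protocol after each history
of the earlier rounds. The individual coalitions are captured by splitting the players into `N`
blocks: by the pigeonhole principle, for a fraction `2⁻ᴺ` of the histories they meet the same few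
blocks, whose union is corrupted as well. Whether a history is one of these is a protocol with one
round less, which gives `1` with probability at least `(p / 4) 2⁻ᴺ` (`exists_reduction`). With
`m` a small multiple of `log⁽ᵏ⁾ ℓ`, the number `log (1 / p) + N` stays below the square root of
`log⁽ᵏ⁻¹⁾ ℓ = 2 ^ log⁽ᵏ⁾ ℓ`, so the tiny probability is affordable one round earlier, and the costs
of the rounds form a geometric series dominated by `ℓ / log⁽ᵏ⁾ ℓ` (`exists_coalition_of_log_le`).
The error probabilities `p` decrease geometrically as well, so they add up to at most the first one.

Rushing adversaries are handled through the value of the game, `gameValue`, which is monotone in the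
coalition and is attained by a strategy (`exists_strategy_eq_gameValue`).
-/

open Finset
open scoped BigOperators

namespace CoinFlip

/-! ### Expectations over product spaces -/

lemma expect_fin_cons {α : Type*} [Fintype α] {n : ℕ} (F : (Fin (n + 1) → α) → ℝ) :
    𝔼 x, F x = 𝔼 a, 𝔼 y, F (Fin.cons a y) := by
  have h := Finset.expect_product' (univ : Finset α) (univ : Finset (Fin n → α))
    (fun a y => F (Fin.cons a y))
  rw [← h, univ_product_univ]
  exact (Fintype.expect_equiv (Fin.consEquiv fun _ => α) _ _ fun _ => rfl).symm

lemma expect_bool (F : Bool → ℝ) : 𝔼 b, F b = (F true + F false) / 2 := by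
  rw [Fintype.expect_eq_sum_div_card]; simp

lemma sum_fin_cons_bool {n : ℕ} (F : (Fin (n + 1) → Bool) → ℝ) :
    ∑ x, F x = ∑ y, F (Fin.cons true y) + ∑ y, F (Fin.cons false y) := by
  rw [← (Fin.consEquiv fun _ => Bool).sum_comp, Fintype.sum_prod_type]
  simp [Fin.consEquiv]

/-! ### Walsh coefficients -/

/-- The Walsh character attached to the set of coordinates `s`, encoded by its indicator. -/
def walshChar {n : ℕ} (s x : Fin n → Bool) : ℝ := ∏ i, if s i && x i then (-1) else 1

/-- The Walsh–Fourier coefficient of `f` at the set with indicator `s`. -/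
noncomputable def walsh {n : ℕ} (f : (Fin n → Bool) → ℝ) (s : Fin n → Bool) : ℝ :=
  𝔼 x, walshChar s x * f x

/-- The number of elements of the set with indicator `s`. -/
def weight {n : ℕ} (s : Fin n → Bool) : ℕ := (univ.filter fun i => s i = true).card

/-- The quadratic form `⟨f, T_ρ f⟩` of the noise operator, written in Walsh coefficients. -/
noncomputable def noiseForm {n : ℕ} (ρ : ℝ) (f : (Fin n → Bool) → ℝ) : ℝ :=
  ∑ s, ρ ^ weight s * walsh f s ^ 2

lemma weight_cons {n : ℕ} (b : Bool) (s : Fin n → Bool) :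
    weight (Fin.cons b s : Fin (n + 1) → Bool) = (if b then 1 else 0) + weight s := by
  unfold weight
  rw [Fin.card_filter_univ_succ]
  simp only [Fin.cons_zero, Fin.cons_succ]
  cases b <;> simp [add_comm]

lemma walsh_cons {n : ℕ} (f : (Fin (n + 1) → Bool) → ℝ) (b : Bool) (s : Fin n → Bool) :
    walsh f (Fin.cons b s) =
      (walsh (fun y => f (Fin.cons false y)) s
        + (if b then -1 else 1) * walsh (fun y => f (Fin.cons true y)) s) / 2 := by
  unfold walsh
  rw [expect_fin_cons, expect_bool, add_comm, mul_expect]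
  congr 2 <;> refine expect_congr rfl fun y _ => ?_
  · simp [walshChar, Fin.prod_univ_succ]
  · cases b <;> simp [walshChar, Fin.prod_univ_succ]

lemma noiseForm_succ {n : ℕ} (ρ : ℝ) (f : (Fin (n + 1) → Bool) → ℝ) :
    noiseForm ρ f =
      (1 + ρ) / 4 * (noiseForm ρ (fun y => f (Fin.cons false y))
        + noiseForm ρ (fun y => f (Fin.cons true y)))
      + (1 - ρ) / 2 * ∑ s, ρ ^ weight s * (walsh (fun y => f (Fin.cons false y)) s
          * walsh (fun y => f (Fin.cons true y)) s) := by
  unfold noiseForm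
  rw [sum_fin_cons_bool]
  simp only [← sum_add_distrib, mul_sum]
  refine sum_congr rfl fun s _ => ?_
  rw [walsh_cons, walsh_cons, weight_cons, weight_cons, pow_add]
  simp only [if_true, Bool.false_eq_true, if_false, pow_one]
  ring

/-- Parseval's identity. -/
lemma sum_walsh_sq {n : ℕ} (f : (Fin n → Bool) → ℝ) : ∑ s, walsh f s ^ 2 = 𝔼 x, f x ^ 2 := by
  suffices h : noiseForm 1 f = 𝔼 x, f x ^ 2 by simpa [noiseForm] using h
  induction n with
  | zero => simp [noiseForm, walsh, walshChar]
  | succ n ih => rw [noiseForm_succ, ih, ih, expect_fin_cons, expect_bool]; ring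

/-! ### Hypercontractivity for functions with values in `{-1, 0, 1}` -/

lemma two_point_poly {x y : ℝ} (hx : 0 ≤ x) (hy : 0 ≤ y) :
    8 * (x ^ 6 + x ^ 3 * y ^ 3 + y ^ 6) ^ 2 ≤ 9 * (x ^ 4 + y ^ 4) ^ 3 := by
  have h : 9 * (x ^ 4 + y ^ 4) ^ 3 - 8 * (x ^ 6 + x ^ 3 * y ^ 3 + y ^ 6) ^ 2 =
      (x - y) ^ 4 * (x ^ 8 + 4 * x ^ 7 * y + 9 * x ^ 6 * y ^ 2 + 4 * x ^ 5 * y ^ 3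
        + (x ^ 3 * y - x * y ^ 3) ^ 2
        + 4 * x ^ 3 * y ^ 5 + 9 * x ^ 2 * y ^ 6 + 4 * x * y ^ 7 + y ^ 8) := by ring
  have : 0 ≤ 9 * (x ^ 4 + y ^ 4) ^ 3 - 8 * (x ^ 6 + x ^ 3 * y ^ 3 + y ^ 6) ^ 2 := by
    rw [h]; positivity
  linarith

/-- The inequality between the two halves of the cube that drives `noiseForm_third_sq_le`. -/
lemma two_point_ineq {a b c μ ν : ℝ} (hb : 0 ≤ b) (hμ : 0 ≤ μ) (hν : 0 ≤ ν)
    (hc : c ^ 2 ≤ a * b) (h₁ : a ^ 2 ≤ μ ^ 3) (h₂ : b ^ 2 ≤ ν ^ 3) (h0 : 0 ≤ a + b + c) :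
    ((a + b + c) / 3) ^ 2 ≤ ((μ + ν) / 2) ^ 3 := by
  obtain ⟨x, hx, rfl⟩ : ∃ x, 0 ≤ x ∧ x ^ 4 = μ :=
    ⟨√√μ, by positivity, by
      rw [show 4 = 2 * 2 from rfl, pow_mul, Real.sq_sqrt (by positivity), Real.sq_sqrt hμ]⟩
  obtain ⟨y, hy, rfl⟩ : ∃ y, 0 ≤ y ∧ y ^ 4 = ν :=
    ⟨√√ν, by positivity, by
      rw [show 4 = 2 * 2 from rfl, pow_mul, Real.sq_sqrt (by positivity), Real.sq_sqrt hν]⟩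
  have ha' : a ≤ x ^ 6 := le_of_sq_le_sq (by nlinarith) (by positivity)
  have hb' : b ≤ y ^ 6 := le_of_sq_le_sq (by nlinarith) (by positivity)
  have hc' : c ≤ x ^ 3 * y ^ 3 := by
    refine le_of_sq_le_sq (hc.trans ?_) (by positivity)
    calc a * b ≤ x ^ 6 * y ^ 6 := by gcongr
      _ = _ := by ring
  have h1 : (a + b + c) ^ 2 ≤ (x ^ 6 + x ^ 3 * y ^ 3 + y ^ 6) ^ 2 :=
    pow_le_pow_left₀ h0 (by linarith) 2
  have h2 := two_point_poly hx hy
  nlinarith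

lemma noiseForm_nonneg {n : ℕ} {ρ : ℝ} (hρ : 0 ≤ ρ) (f : (Fin n → Bool) → ℝ) :
    0 ≤ noiseForm ρ f := by unfold noiseForm; positivity

/-- The `(4/3, 2)`-hypercontractive inequality for a function with values in `{-1, 0, 1}`, whose
`4/3`-norm is a power of the probability that it does not vanish. As both restrictions of such a
function to a half cube have values in `{-1, 0, 1}` again, induction on the dimension needs no
other norms. -/
lemma noiseForm_third_sq_le {n : ℕ} (f : (Fin n → Bool) → ℝ)
    (hf : ∀ x, f x = 0 ∨ f x = 1 ∨ f x = -1) :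
    noiseForm (1 / 3) f ^ 2 ≤ (𝔼 x, f x ^ 2) ^ 3 := by
  induction n with
  | zero =>
    have key : ∀ x, (f x ^ 2) ^ 2 ≤ (f x ^ 2) ^ 3 := fun x => by
      rcases hf x with h | h | h <;> simp [h]
    simpa [noiseForm, walsh, walshChar, weight] using key _
  | succ n ih =>
    have h0 := ih (fun y => f (Fin.cons false y)) fun _ => hf _
    have h1 := ih (fun y => f (Fin.cons true y)) fun _ => hf _
    have hE : 𝔼 x, f x ^ 2 =
        (𝔼 y, f (Fin.cons false y) ^ 2 + 𝔼 y, f (Fin.cons true y) ^ 2) / 2 := by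
      rw [expect_fin_cons, expect_bool, add_comm]
    set c := ∑ s, (1 / 3 : ℝ) ^ weight s * (walsh (fun y => f (Fin.cons false y)) s
          * walsh (fun y => f (Fin.cons true y)) s) with hc
    have hN := noiseForm_succ (1 / 3) f
    rw [← hc] at hN
    have hN' : noiseForm (1 / 3) f = (noiseForm (1 / 3) (fun y => f (Fin.cons false y))
        + noiseForm (1 / 3) (fun y => f (Fin.cons true y)) + c) / 3 := by rw [hN]; ring
    have hpos : 0 ≤ noiseForm (1 / 3) f := noiseForm_nonneg (by norm_num) f
    rw [hE, hN']
    refine two_point_ineq (noiseForm_nonneg (by norm_num) _)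
      (expect_nonneg fun _ _ => sq_nonneg _) (expect_nonneg fun _ _ => sq_nonneg _) ?_ h0 h1
      (by linarith)
    exact sum_sq_le_sum_mul_sum_of_sq_le_mul _ (fun _ _ => by positivity)
      (fun _ _ => by positivity) (fun s _ => le_of_eq (by ring))

/-! ### Influences -/

/-- Flip one coordinate of a point of the cube. -/
def flipAt {n : ℕ} (i : Fin n) (x : Fin n → Bool) : Fin n → Bool := Function.update x i (!x i)

lemma flipAt_flipAt {n : ℕ} (i : Fin n) (x : Fin n → Bool) : flipAt i (flipAt i x) = x := by
  simp [flipAt]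

lemma expect_flipAt {n : ℕ} (i : Fin n) (F : (Fin n → Bool) → ℝ) :
    𝔼 x, F (flipAt i x) = 𝔼 x, F x :=
  Fintype.expect_equiv (Function.Involutive.toPerm (flipAt i) (flipAt_flipAt i)) _ _ fun _ => rfl

/-- The influence of the coordinate `i` on `f`; for `f` with values in `{0, 1}` it is the
probability that flipping `i` changes the value of `f`. -/
noncomputable def influence {n : ℕ} (f : (Fin n → Bool) → ℝ) (i : Fin n) : ℝ :=
  𝔼 x, (f x - f (flipAt i x)) ^ 2

lemma influence_nonneg {n : ℕ} (f : (Fin n → Bool) → ℝ) (i : Fin n) : 0 ≤ influence f i :=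
  expect_nonneg fun _ _ => sq_nonneg _

lemma walshChar_flipAt {n : ℕ} (s x : Fin n → Bool) (i : Fin n) :
    walshChar s (flipAt i x) = (if s i then -1 else 1) * walshChar s x := by
  unfold walshChar
  rw [← mul_prod_erase univ _ (mem_univ i), ← mul_prod_erase univ _ (mem_univ i), ← mul_assoc]
  congr 1
  · cases h : s i <;> cases h' : x i <;> simp [flipAt, h']
  · refine prod_congr rfl fun j hj => ?_
    simp [flipAt, Function.update_of_ne (ne_of_mem_erase hj)]

lemma walsh_sub_flipAt {n : ℕ} (f : (Fin n → Bool) → ℝ) (i : Fin n) (s : Fin n → Bool) :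
    walsh (fun x => f x - f (flipAt i x)) s = if s i then 2 * walsh f s else 0 := by
  have h : 𝔼 x, walshChar s x * f (flipAt i x) = (if s i then -1 else 1) * walsh f s := by
    unfold walsh
    rw [← expect_flipAt i, mul_expect]
    refine expect_congr rfl fun x _ => ?_
    rw [flipAt_flipAt, walshChar_flipAt]; ring
  have h' : walsh (fun x => f x - f (flipAt i x)) s =
      walsh f s - 𝔼 x, walshChar s x * f (flipAt i x) := by
    unfold walsh
    rw [← expect_sub_distrib]
    exact expect_congr rfl fun x _ => by ring
  rw [h', h]
  split_ifs <;> ring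

lemma sum_noiseForm_sub_flipAt {n : ℕ} (ρ : ℝ) (f : (Fin n → Bool) → ℝ) :
    ∑ i, noiseForm ρ (fun x => f x - f (flipAt i x)) =
      ∑ s, 4 * weight s * ρ ^ weight s * walsh f s ^ 2 := by
  unfold noiseForm
  rw [sum_comm]
  refine sum_congr rfl fun s _ => ?_
  have : ∀ i, ρ ^ weight s * walsh (fun x => f x - f (flipAt i x)) s ^ 2 =
      if s i = true then 4 * ρ ^ weight s * walsh f s ^ 2 else 0 := by
    intro i
    rw [walsh_sub_flipAt]
    split_ifs <;> ring
  rw [sum_congr rfl fun i _ => this i, ← sum_filter, sum_const, nsmul_eq_mul]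
  unfold weight
  ring

lemma sum_influence {n : ℕ} (f : (Fin n → Bool) → ℝ) :
    ∑ i, influence f i = ∑ s, 4 * weight s * walsh f s ^ 2 := by
  have h := sum_noiseForm_sub_flipAt 1 f
  simp only [one_pow, mul_one] at h
  rw [← h]
  refine sum_congr rfl fun i _ => ?_
  simp [noiseForm, influence, sum_walsh_sq]

lemma walsh_const_false {n : ℕ} (f : (Fin n → Bool) → ℝ) : walsh f (fun _ => false) = 𝔼 x, f x := by
  simp [walsh, walshChar]

lemma weight_eq_zero_iff {n : ℕ} {s : Fin n → Bool} : weight s = 0 ↔ s = fun _ => false := by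
  simp [weight, funext_iff, filter_eq_empty_iff]

/-- The Kahn–Kalai–Linial inequality: if every influence of a function with values in `{0, 1}` is
at most `36⁻ᵐ`, its total influence exceeds `2m` times its variance. Otherwise half of the variance
would sit on Walsh coefficients of weight between `1` and `m`, which `noiseForm_third_sq_le`,
applied to the discrete derivatives, does not allow. -/
theorem kkl {n : ℕ} (f : (Fin n → Bool) → ℝ) (hf : ∀ x, f x = 0 ∨ f x = 1) {m : ℕ} (hm : 1 ≤ m)
    (hv : 0 < (𝔼 x, f x) * (1 - 𝔼 x, f x)) (hinf : ∀ i, influence f i ≤ (1 / 36) ^ m) :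
    2 * m * ((𝔼 x, f x) * (1 - 𝔼 x, f x)) < ∑ i, influence f i := by
  set v := (𝔼 x, f x) * (1 - 𝔼 x, f x) with hvdef
  by_contra! hI
  have hm0 : (0 : ℝ) < m := by exact_mod_cast hm
  have hvar : ∑ s ∈ univ.erase (fun _ => false), walsh f s ^ 2 = v := by
    have h := sum_walsh_sq f
    rw [← add_sum_erase univ _ (mem_univ fun _ => false), walsh_const_false] at h
    have h2 : 𝔼 x, f x ^ 2 = 𝔼 x, f x := expect_congr rfl fun x _ => by
      rcases hf x with h | h <;> simp [h]
    rw [h2] at h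
    rw [hvdef]; linarith
  -- The derivatives of `f` have small noise forms by hypercontractivity.
  have hnoise : ∀ i, noiseForm (1 / 3) (fun x => f x - f (flipAt i x)) ≤
      (1 / 6) ^ m * influence f i := by
    intro i
    have h1 := noiseForm_third_sq_le (fun x => f x - f (flipAt i x)) fun x => by
      rcases hf x with h | h <;> rcases hf (flipAt i x) with h' | h' <;> simp [h, h']
    have h0 := influence_nonneg f i
    refine le_of_sq_le_sq (h1.trans ?_) (by positivity)
    change influence f i ^ 3 ≤ _
    calc influence f i ^ 3 = influence f i * influence f i ^ 2 := by ring
      _ ≤ (1 / 36) ^ m * influence f i ^ 2 := by gcongr; exact hinf i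
      _ = _ := by rw [mul_pow, ← pow_mul, mul_comm m 2, pow_mul]; norm_num
  have hup : ∑ s, 4 * weight s * (1 / 3 : ℝ) ^ weight s * walsh f s ^ 2 ≤
      (1 / 6) ^ m * (2 * m * v) := by
    rw [← sum_noiseForm_sub_flipAt]
    calc _ ≤ ∑ i, (1 / 6 : ℝ) ^ m * influence f i := sum_le_sum fun i _ => hnoise i
      _ = (1 / 6) ^ m * ∑ i, influence f i := by rw [mul_sum]
      _ ≤ _ := by gcongr
  -- Compare term by term: a nonempty set has weight at most `m`, or it is charged to the total
  -- influence.
  have hterm : ∀ s ∈ univ.erase (fun _ : Fin n => false), walsh f s ^ 2 ≤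
      3 ^ m / 4 * (4 * weight s * (1 / 3 : ℝ) ^ weight s * walsh f s ^ 2)
        + 1 / (4 * (m + 1)) * (4 * weight s * walsh f s ^ 2) := by
    intro s hs
    have hs0 : 1 ≤ weight s := Nat.one_le_iff_ne_zero.2 fun h =>
      ne_of_mem_erase hs (weight_eq_zero_iff.1 h)
    have hs1 : (1 : ℝ) ≤ weight s := by exact_mod_cast hs0
    rcases le_or_gt (weight s) m with h | h
    · have h3 : (1 : ℝ) ≤ 3 ^ m * (1 / 3 : ℝ) ^ weight s := by
        rw [one_div, inv_pow, ← div_eq_mul_inv, one_le_div (by positivity)]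
        exact pow_le_pow_right₀ (by norm_num) h
      have h4 : (1 : ℝ) ≤ weight s * (3 ^ m * (1 / 3 : ℝ) ^ weight s) := by nlinarith
      have h5 : 0 ≤ 1 / (4 * ((m : ℝ) + 1)) * (4 * weight s * walsh f s ^ 2) := by positivity
      nlinarith [sq_nonneg (walsh f s)]
    · have h3 : (1 : ℝ) ≤ weight s / (m + 1) := by
        rw [one_le_div (by positivity)]; exact_mod_cast h
      have h5 : 0 ≤ 3 ^ m / 4 * (4 * weight s * (1 / 3 : ℝ) ^ weight s * walsh f s ^ 2) := by
        positivity
      have h6 : 1 / (4 * ((m : ℝ) + 1)) * (4 * weight s * walsh f s ^ 2) =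
          weight s / (m + 1) * walsh f s ^ 2 := by field_simp
      rw [h6]
      nlinarith [sq_nonneg (walsh f s)]
  have hsum := sum_le_sum hterm
  rw [hvar, sum_add_distrib, ← mul_sum, ← mul_sum] at hsum
  have hA : ∑ s ∈ univ.erase (fun _ : Fin n => false),
      4 * weight s * (1 / 3 : ℝ) ^ weight s * walsh f s ^ 2 ≤ (1 / 6) ^ m * (2 * m * v) :=
    (sum_le_sum_of_subset_of_nonneg (erase_subset _ _) fun _ _ _ => by positivity).trans hup
  have hB : ∑ s ∈ univ.erase (fun _ : Fin n => false), 4 * weight s * walsh f s ^ 2 ≤ 2 * m * v :=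
    (sum_le_sum_of_subset_of_nonneg (erase_subset _ _) fun _ _ _ => by positivity).trans
      ((sum_influence f).symm.le.trans hI)
  have hC : (3 : ℝ) ^ m / 4 * ((1 / 6) ^ m * (2 * m * v)) ≤ v / 4 := by
    have h36 : (3 : ℝ) ^ m * (1 / 6) ^ m = 1 / 2 ^ m := by
      rw [← mul_pow, ← one_div_pow]; norm_num
    have h2m : 2 * (m : ℝ) ≤ 2 ^ m := by
      obtain ⟨k, rfl⟩ := Nat.exists_eq_add_of_le' hm
      have : k + 1 ≤ 2 ^ k := Nat.lt_two_pow_self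
      rw [pow_succ, mul_comm]
      gcongr
      exact_mod_cast this
    have h7 : 2 * (m : ℝ) / 2 ^ m ≤ 1 := (div_le_one (by positivity)).2 h2m
    calc (3 : ℝ) ^ m / 4 * ((1 / 6) ^ m * (2 * m * v))
        = ((3 : ℝ) ^ m * (1 / 6) ^ m) * (2 * m * v) / 4 := by ring
      _ = 2 * (m : ℝ) / 2 ^ m * v / 4 := by rw [h36]; ring
      _ ≤ 1 * v / 4 := by gcongr
      _ = v / 4 := by ring
  have hD : 1 / (4 * ((m : ℝ) + 1)) * (2 * m * v) < v / 2 := by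
    rw [div_mul_eq_mul_div, one_mul, div_lt_iff₀ (by positivity)]
    nlinarith
  have hA' := mul_le_mul_of_nonneg_left hA (show (0 : ℝ) ≤ 3 ^ m / 4 by positivity)
  have hB' := mul_le_mul_of_nonneg_left hB (show (0 : ℝ) ≤ 1 / (4 * ((m : ℝ) + 1)) by positivity)
  linarith

/-! ### The effect of a coalition on one round -/

/-- The messages that a coalition `B` can produce by changing its own bits in `x`. -/
def reachable {n : ℕ} (B : Finset (Fin n)) (x : Fin n → Bool) : Finset (Fin n → Bool) :=
  univ.filter fun y => ∀ j, j ∉ B → y j = x j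

lemma mem_reachable {n : ℕ} {B : Finset (Fin n)} {x y : Fin n → Bool} :
    y ∈ reachable B x ↔ ∀ j, j ∉ B → y j = x j := by simp [reachable]

lemma self_mem_reachable {n : ℕ} (B : Finset (Fin n)) (x : Fin n → Bool) : x ∈ reachable B x :=
  mem_reachable.2 fun _ _ => rfl

/-- The largest value of `F` that the coalition `B` can force when the other players send their
bits of `x`. The bits of `x` inside `B` are irrelevant; keeping them lets all expectations run over
the same cube. -/
noncomputable def boost {n : ℕ} (B : Finset (Fin n)) (F : (Fin n → Bool) → ℝ) (x : Fin n → Bool) :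
    ℝ :=
  (reachable B x).sup' ⟨x, self_mem_reachable B x⟩ F

lemma le_boost {n : ℕ} {B : Finset (Fin n)} (F : (Fin n → Bool) → ℝ) {x y : Fin n → Bool}
    (h : y ∈ reachable B x) : F y ≤ boost B F x := le_sup' F h

lemma exists_boost_eq {n : ℕ} (B : Finset (Fin n)) (F : (Fin n → Bool) → ℝ) (x : Fin n → Bool) :
    ∃ y ∈ reachable B x, boost B F x = F y := exists_mem_eq_sup' _ F

lemma boost_mono_left {n : ℕ} {B B' : Finset (Fin n)} (h : B ⊆ B') (F : (Fin n → Bool) → ℝ)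
    (x : Fin n → Bool) : boost B F x ≤ boost B' F x := by
  obtain ⟨y, hy, e⟩ := exists_boost_eq B F x
  rw [e]
  exact le_boost F (mem_reachable.2 fun j hj => mem_reachable.1 hy j fun h' => hj (h h'))

lemma boost_mono_right {n : ℕ} (B : Finset (Fin n)) {F G : (Fin n → Bool) → ℝ}
    (h : ∀ x, F x ≤ G x) (x : Fin n → Bool) : boost B F x ≤ boost B G x := by
  obtain ⟨y, hy, e⟩ := exists_boost_eq B F x
  rw [e]
  exact (h y).trans (le_boost G hy)

lemma boost_const_mul {n : ℕ} (B : Finset (Fin n)) (F : (Fin n → Bool) → ℝ) {c : ℝ} (hc : 0 ≤ c)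
    (x : Fin n → Bool) : boost B (fun y => c * F y) x = c * boost B F x := by
  refine le_antisymm ?_ ?_
  · obtain ⟨y, hy, e⟩ := exists_boost_eq B (fun y => c * F y) x
    rw [e]
    exact mul_le_mul_of_nonneg_left (le_boost F hy) hc
  · obtain ⟨y, hy, e⟩ := exists_boost_eq B F x
    rw [e]
    exact le_boost (fun y => c * F y) hy

lemma boost_empty {n : ℕ} (F : (Fin n → Bool) → ℝ) (x : Fin n → Bool) : boost ∅ F x = F x := by
  obtain ⟨y, hy, e⟩ := exists_boost_eq ∅ F x
  rw [e, show y = x from funext fun j => mem_reachable.1 hy j (notMem_empty j)]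

lemma boost_insert {n : ℕ} (i : Fin n) (B : Finset (Fin n)) (F : (Fin n → Bool) → ℝ)
    (x : Fin n → Bool) :
    boost (insert i B) F x = max (boost B F x) (boost B F (flipAt i x)) := by
  refine le_antisymm ?_ (max_le (boost_mono_left (subset_insert i B) F x) ?_)
  · obtain ⟨y, hy, e⟩ := exists_boost_eq (insert i B) F x
    rw [e]
    rw [mem_reachable] at hy
    by_cases h : y i = x i
    · refine le_max_of_le_left (le_boost F (mem_reachable.2 fun j hj => ?_))
      by_cases hji : j = i
      · rw [hji, h]
      · exact hy j (by simp [hji, hj])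
    · refine le_max_of_le_right (le_boost F (mem_reachable.2 fun j hj => ?_))
      by_cases hji : j = i
      · subst hji
        simpa [flipAt] using Bool.eq_not_of_ne h
      · rw [flipAt, Function.update_of_ne hji]
        exact hy j (by simp [hji, hj])
  · obtain ⟨y, hy, e⟩ := exists_boost_eq B F (flipAt i x)
    rw [e]
    refine le_boost F (mem_reachable.2 fun j hj => ?_)
    rw [mem_insert, not_or] at hj
    rw [mem_reachable.1 hy j hj.2, flipAt, Function.update_of_ne hj.1]

lemma boost_zero_or_one {n : ℕ} (B : Finset (Fin n)) {F : (Fin n → Bool) → ℝ}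
    (hF : ∀ x, F x = 0 ∨ F x = 1) (x : Fin n → Bool) : boost B F x = 0 ∨ boost B F x = 1 := by
  obtain ⟨y, -, e⟩ := exists_boost_eq B F x
  rw [e]; exact hF y

/-- Corrupting one more player raises the expectation by half the influence of that player. -/
lemma expect_boost_insert {n : ℕ} (i : Fin n) (B : Finset (Fin n)) {F : (Fin n → Bool) → ℝ}
    (hF : ∀ x, F x = 0 ∨ F x = 1) :
    𝔼 x, boost (insert i B) F x = 𝔼 x, boost B F x + influence (boost B F) i / 2 := by
  have h : ∀ x, boost (insert i B) F x =
      boost B F x / 2 + boost B F (flipAt i x) / 2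
        + (boost B F x - boost B F (flipAt i x)) ^ 2 / 2 := by
    intro x
    rw [boost_insert]
    rcases boost_zero_or_one B hF x with h | h <;>
      rcases boost_zero_or_one B hF (flipAt i x) with h' | h' <;> rw [h, h'] <;> norm_num
  rw [expect_congr rfl fun x _ => h x, expect_add_distrib, expect_add_distrib, ← expect_div,
    ← expect_div, ← expect_div, expect_flipAt i (boost B F)]
  unfold influence
  ring

/-! ### The potential -/

/-- A potential on `[p, 1]` that behaves like `log (q / (1 - q))` up to `q = 1 - p` and remains
bounded beyond. -/
noncomputable def potential (p q : ℝ) : ℝ := Real.log q - Real.log (1 - q + p)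

lemma log_le_potential {p q : ℝ} (hp : 0 < p) (hpq : p ≤ q) (hq : q ≤ 1) :
    Real.log p ≤ potential p q := by
  have h1 := Real.log_le_log hp hpq
  have h2 : Real.log (1 - q + p) ≤ 0 := Real.log_nonpos (by linarith) (by linarith)
  unfold potential; linarith

lemma potential_le {p q : ℝ} (hp : 0 < p) (hpq : p ≤ q) (hq : q ≤ 1) :
    potential p q ≤ -Real.log p := by
  have h1 := Real.log_nonpos (hp.le.trans hpq) hq
  have h2 : Real.log p ≤ Real.log (1 - q + p) := Real.log_le_log hp (by linarith)
  unfold potential; linarith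

lemma potential_mono {p q q' : ℝ} (hp : 0 < p) (hpq : p ≤ q) (hqq : q ≤ q') (hq : q' ≤ 1) :
    potential p q ≤ potential p q' := by
  have h1 : Real.log q ≤ Real.log q' := Real.log_le_log (hp.trans_le hpq) hqq
  have h2 : Real.log (1 - q' + p) ≤ Real.log (1 - q + p) :=
    Real.log_le_log (by linarith) (by linarith)
  unfold potential; linarith

/-- As long as the potential grows by less than `1 / 2`, it grows at the rate of the logit. -/
lemma div_le_potential_sub {p q d : ℝ} (hp : 0 < p) (hpq : p ≤ q) (hq : q < 1 - p) (hd : 0 ≤ d)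
    (hqd : q + d ≤ 1) (hsmall : potential p (q + d) - potential p q < 1 / 2) :
    d / (2 * (q * (1 - q))) ≤ potential p (q + d) - potential p q := by
  have hq0 : 0 < q := hp.trans_le hpq
  have h1q : 0 < 1 - q := by linarith
  have h1 : d / (q + d) ≤ Real.log (q + d) - Real.log q := by
    have h := Real.one_sub_inv_le_log_of_pos (show 0 < (q + d) / q by positivity)
    rw [Real.log_div (by positivity) (by positivity)] at h
    refine le_trans (le_of_eq ?_) h
    field_simp; ring
  have h2 : d / (1 - q + p) ≤ Real.log (1 - q + p) - Real.log (1 - (q + d) + p) := by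
    have h0 : 0 < 1 - (q + d) + p := by linarith
    have h0' : 0 < 1 - q + p := by linarith
    have h := Real.log_le_sub_one_of_pos (div_pos h0 h0')
    rw [Real.log_div h0.ne' h0'.ne'] at h
    have : (1 - (q + d) + p) / (1 - q + p) - 1 = -(d / (1 - q + p)) := by field_simp; ring
    linarith
  have h3 : 0 ≤ d / (1 - q + p) := div_nonneg hd (by linarith)
  have hdq : d ≤ q := by
    by_contra! h
    have : 1 / 2 ≤ d / (q + d) := by rw [div_le_div_iff₀ (by norm_num) (by positivity)]; linarith
    unfold potential at hsmall; linarith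
  have h4 : d / (2 * q) ≤ d / (q + d) := by gcongr; linarith
  have h5 : d / (2 * (1 - q)) ≤ d / (1 - q + p) :=
    div_le_div_of_nonneg_left hd (by linarith) (by linarith)
  have h6 : d / (2 * (q * (1 - q))) = d / (2 * q) + d / (2 * (1 - q)) := by field_simp; ring
  unfold potential; linarith

/-! ### Biasing most functions of a family -/

lemma expect_le_one_of_zero_or_one {n : ℕ} {F : (Fin n → Bool) → ℝ}
    (hF : ∀ x, F x = 0 ∨ F x = 1) : 𝔼 x, F x ≤ 1 :=
  expect_le univ_nonempty fun x _ => by rcases hF x with h | h <;> simp [h]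

lemma expect_le_expect_boost {n : ℕ} (B : Finset (Fin n)) (F : (Fin n → Bool) → ℝ) :
    𝔼 x, F x ≤ 𝔼 x, boost B F x :=
  expect_le_expect fun x _ => le_boost F (self_mem_reachable B x)

/-- If no single player raises the potential of `𝔼 (boost B F)` by more than `36⁻ᵐ`, then all
players together raise it by more than `m / 2`, unless the expectation is already at least
`1 - p`. -/
lemma half_lt_sum_potential_sub {n : ℕ} (B : Finset (Fin n)) {F : (Fin n → Bool) → ℝ}
    (hF : ∀ x, F x = 0 ∨ F x = 1) {p : ℝ} (hp : 0 < p) (hE : p ≤ 𝔼 x, F x)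
    (hlt : 𝔼 x, boost B F x < 1 - p) {m : ℕ} (hm : 1 ≤ m)
    (hstep : ∀ i, potential p (𝔼 x, boost (insert i B) F x) - potential p (𝔼 x, boost B F x) ≤
      (1 / 36) ^ m) :
    (m : ℝ) / 2 <
      ∑ i, (potential p (𝔼 x, boost (insert i B) F x) - potential p (𝔼 x, boost B F x)) := by
  set q := 𝔼 x, boost B F x with hq
  have hpq : p ≤ q := hE.trans (expect_le_expect_boost B F)
  have hv : 0 < q * (1 - q) := mul_pos (hp.trans_le hpq) (by linarith)
  have hα : (1 / 36 : ℝ) ^ m < 1 / 2 :=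
    (pow_le_of_le_one (by norm_num) (by norm_num) (by omega)).trans_lt (by norm_num)
  have hΔ : ∀ i, influence (boost B F) i / (4 * (q * (1 - q))) ≤
      potential p (𝔼 x, boost (insert i B) F x) - potential p q := by
    intro i
    have hs := hstep i
    have hle := expect_le_one_of_zero_or_one (boost_zero_or_one (insert i B) hF)
    rw [expect_boost_insert i B hF, ← hq] at hs hle ⊢
    have h := div_le_potential_sub hp hpq hlt
      (div_nonneg (influence_nonneg (boost B F) i) (by norm_num)) hle (hs.trans_lt hα)
    refine le_trans (le_of_eq ?_) h
    field_simp; ring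
  have hinf : ∀ i, influence (boost B F) i ≤ (1 / 36) ^ m := by
    intro i
    have h := (hΔ i).trans (hstep i)
    rw [div_le_iff₀ (by positivity)] at h
    have h4 : 4 * (q * (1 - q)) ≤ 1 := by nlinarith [sq_nonneg (2 * q - 1)]
    exact h.trans (mul_le_of_le_one_right (by positivity) h4)
  have hk := kkl (boost B F) (boost_zero_or_one B hF) hm hv hinf
  rw [← hq] at hk
  calc (m : ℝ) / 2 = 2 * m * (q * (1 - q)) / (4 * (q * (1 - q))) := by
        rw [eq_div_iff (by positivity)]; ring
    _ < (∑ i, influence (boost B F) i) / (4 * (q * (1 - q))) := by gcongr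
    _ = ∑ i, influence (boost B F) i / (4 * (q * (1 - q))) := by rw [sum_div]
    _ ≤ _ := sum_le_sum fun i _ => hΔ i

/-- A family of functions, each of expectation at least `p`, has a common coalition `B` and small
individual coalitions `S a` such that `B ∪ S a` biases the function with index `a` to `1 - p`, for
at least half of the indices. The coalitions maximize the total potential minus a charge for
corrupted players: the charge bounds their sizes, and the impossibility of improving on them by one
player bounds, through the Kahn–Kalai–Linial inequality, the number of functions not yet biased. -/
theorem exists_common_and_individual_coalitions {A : Type*} [Fintype A] [Nonempty A] {n : ℕ}
    (hn : 0 < n) (f : A → (Fin n → Bool) → ℝ) (hf : ∀ a x, f a x = 0 ∨ f a x = 1) {p : ℝ}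
    (hp : 0 < p) (hE : ∀ a, p ≤ 𝔼 x, f a x) {m : ℕ} (hm : 1 ≤ m) :
    ∃ (B : Finset (Fin n)) (S : A → Finset (Fin n)),
      (#B : ℝ) ≤ 8 * (-Real.log p) * n / m ∧
      (∀ a, (#(S a) : ℝ) ≤ 2 * (-Real.log p) * 36 ^ m) ∧
      (Fintype.card A : ℝ) ≤ 2 * #(univ.filter fun a => 1 - p ≤ 𝔼 x, boost (B ∪ S a) (f a) x) := by
  classical
  have hn0 : (0 : ℝ) < n := by exact_mod_cast hn
  have hm0 : (0 : ℝ) < m := by exact_mod_cast hm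
  have hA0 : (0 : ℝ) < Fintype.card A := by exact_mod_cast Fintype.card_pos
  set α : ℝ := (1 / 36) ^ m with hα
  have hα0 : 0 < α := by positivity
  set β : ℝ := m / (4 * n) with hβ
  have hβ0 : 0 < β := by positivity
  let φ : A → Finset (Fin n) → ℝ := fun a C => potential p (𝔼 x, boost C (f a) x)
  let obj : Finset (Fin n) × (A → Finset (Fin n)) → ℝ := fun P =>
    ∑ a, (φ a (P.1 ∪ P.2 a) - α * #(P.2 a)) - β * Fintype.card A * #P.1
  have hge : ∀ a C, p ≤ 𝔼 x, boost C (f a) x := fun a C =>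
    (hE a).trans (expect_le_expect_boost C (f a))
  have hle : ∀ a C, 𝔼 x, boost C (f a) x ≤ 1 := fun a C =>
    expect_le_one_of_zero_or_one (boost_zero_or_one C (hf a))
  have hφ_lo : ∀ a C, Real.log p ≤ φ a C := fun a C => log_le_potential hp (hge a C) (hle a C)
  have hφ_hi : ∀ a C, φ a C ≤ -Real.log p := fun a C => potential_le hp (hge a C) (hle a C)
  have hφ_mono : ∀ a C C', C ⊆ C' → φ a C ≤ φ a C' := fun a C C' h =>
    potential_mono hp (hge a C) (expect_le_expect fun x _ => boost_mono_left h _ x) (hle a C')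
  obtain ⟨⟨B, S⟩, hmax⟩ := Finite.exists_max obj
  -- Changing a single individual coalition does not help.
  have hopt : ∀ a S', φ a (B ∪ S') - α * #S' ≤ φ a (B ∪ S a) - α * #(S a) := by
    intro a S'
    have h := hmax (B, Function.update S a S')
    simp only [obj] at h
    rw [← add_sum_erase univ _ (mem_univ a),
      ← add_sum_erase univ (fun a => φ a (B ∪ S a) - α * #(S a)) (mem_univ a),
      sum_congr rfl (g := fun a => φ a (B ∪ S a) - α * #(S a)) fun b hb => by
        rw [Function.update_of_ne (ne_of_mem_erase hb)], Function.update_self] at h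
    linarith
  refine ⟨B, S, ?_, fun a => ?_, ?_⟩
  · have h := hmax (∅, fun _ => ∅)
    simp only [obj, card_empty, Nat.cast_zero, mul_zero, sub_zero] at h
    have h1 : (Fintype.card A : ℝ) * Real.log p ≤ ∑ a, φ a (∅ ∪ ∅) := by
      rw [← nsmul_eq_mul, ← card_univ]; exact card_nsmul_le_sum _ _ _ fun a _ => hφ_lo a _
    have h2 : ∑ a, (φ a (B ∪ S a) - α * #(S a)) ≤ (Fintype.card A : ℝ) * -Real.log p := by
      rw [← nsmul_eq_mul, ← card_univ]
      refine sum_le_card_nsmul _ _ _ fun a _ => ?_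
      have : 0 ≤ α * #(S a) := by positivity
      linarith [hφ_hi a (B ∪ S a)]
    have h3 : (Fintype.card A : ℝ) * (β * #B) ≤ Fintype.card A * (2 * -Real.log p) := by linarith
    have h4 := le_of_mul_le_mul_left h3 hA0
    rw [hβ, div_mul_eq_mul_div, div_le_iff₀ (by positivity)] at h4
    rw [le_div_iff₀ hm0]
    linarith
  · have h := hopt a ∅
    rw [card_empty, Nat.cast_zero, mul_zero, sub_zero] at h
    have h1 : α * #(S a) ≤ 2 * -Real.log p := by linarith [hφ_lo a (B ∪ ∅), hφ_hi a (B ∪ S a)]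
    rw [hα, one_div, inv_pow, inv_mul_le_iff₀ (by positivity)] at h1
    linarith
  · set Δ : A → Fin n → ℝ := fun a i => φ a (insert i (B ∪ S a)) - φ a (B ∪ S a) with hΔ
    have hΔ0 : ∀ a i, 0 ≤ Δ a i := fun a i => sub_nonneg.2 (hφ_mono a _ _ (subset_insert _ _))
    have hbad : ∀ a ∈ univ.filter fun a => ¬ 1 - p ≤ 𝔼 x, boost (B ∪ S a) (f a) x,
        (m : ℝ) / 2 ≤ ∑ i, Δ a i := by
      intro a ha
      refine (half_lt_sum_potential_sub (B ∪ S a) (hf a) hp (hE a)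
        (not_le.1 (mem_filter.1 ha).2) hm fun i => ?_).le
      have h := hopt a (insert i (S a))
      have hc : (#(insert i (S a)) : ℝ) ≤ #(S a) + 1 := by exact_mod_cast card_insert_le i (S a)
      rw [union_insert] at h
      have := mul_le_mul_of_nonneg_left hc hα0.le
      change φ a (insert i (B ∪ S a)) - φ a (B ∪ S a) ≤ α
      linarith
    -- Adding any player to the common coalition does not help.
    have hcol : ∀ i, ∑ a, Δ a i ≤ β * Fintype.card A := by
      intro i
      have h := hmax (insert i B, S)
      simp only [obj, sum_sub_distrib, insert_union] at h
      have hc : (#(insert i B) : ℝ) ≤ #B + 1 := by exact_mod_cast card_insert_le i B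
      have := mul_le_mul_of_nonneg_left hc (show 0 ≤ β * Fintype.card A by positivity)
      rw [hΔ, sum_sub_distrib]
      linarith
    have htot : ∑ a, ∑ i, Δ a i ≤ m / 4 * Fintype.card A := by
      rw [sum_comm]
      calc _ ≤ ∑ _i : Fin n, β * Fintype.card A := sum_le_sum fun i _ => hcol i
        _ = m / 4 * Fintype.card A := by
          rw [sum_const, card_univ, Fintype.card_fin, nsmul_eq_mul, hβ]; field_simp
    have hlow : (#(univ.filter fun a => ¬ 1 - p ≤ 𝔼 x, boost (B ∪ S a) (f a) x) : ℝ) * (m / 2) ≤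
        ∑ a, ∑ i, Δ a i := by
      rw [← nsmul_eq_mul]
      exact (card_nsmul_le_sum _ _ _ hbad).trans
        (sum_le_sum_of_subset_of_nonneg (filter_subset _ _) fun a _ _ =>
          sum_nonneg fun i _ => hΔ0 a i)
    have hsplit : (#(univ.filter fun a => 1 - p ≤ 𝔼 x, boost (B ∪ S a) (f a) x) : ℝ)
        + #(univ.filter fun a => ¬ 1 - p ≤ 𝔼 x, boost (B ∪ S a) (f a) x) = Fintype.card A := by
      exact_mod_cast card_filter_add_card_filter_not (s := (univ : Finset A))
        (fun a => 1 - p ≤ 𝔼 x, boost (B ∪ S a) (f a) x)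
    have h := hlow.trans htot
    have h2 : (#(univ.filter fun a => ¬ 1 - p ≤ 𝔼 x, boost (B ∪ S a) (f a) x) : ℝ) * 2 ≤
        Fintype.card A := by
      refine le_of_mul_le_mul_left (a := (m : ℝ) / 4) ?_ (by positivity)
      linarith
    linarith

/-! ### The value of the game -/

/-- The value, after history `h`, of the game of `j` more rounds in which the coalition `B`
maximizes the expectation of the payoff `F`, a function of the list of all messages. -/
noncomputable def gameValue {n : ℕ} (B : Finset (Fin n)) (F : List (Message n) → ℝ) :
    ℕ → List (Message n) → ℝ
  | 0, h => F h
  | j + 1, h => 𝔼 x, boost B (fun y => gameValue B F j (h ++ [y])) x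

lemma gameValue_mono {n : ℕ} {B B' : Finset (Fin n)} (hB : B ⊆ B') {F G : List (Message n) → ℝ}
    (hFG : ∀ h, F h ≤ G h) (j : ℕ) (h : List (Message n)) :
    gameValue B F j h ≤ gameValue B' G j h := by
  induction j generalizing h with
  | zero => exact hFG h
  | succ j ih =>
    exact expect_le_expect fun x _ =>
      (boost_mono_right B (fun y => ih (h ++ [y])) x).trans (boost_mono_left hB _ x)

lemma gameValue_const_mul {n : ℕ} (B : Finset (Fin n)) (F : List (Message n) → ℝ) {c : ℝ}
    (hc : 0 ≤ c) (j : ℕ) (h : List (Message n)) :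
    gameValue B (fun h => c * F h) j h = c * gameValue B F j h := by
  induction j generalizing h with
  | zero => rfl
  | succ j ih => simp only [gameValue, ih, boost_const_mul B _ hc, mul_expect]

/-- The last round can be played first, replacing the payoff by its value. -/
lemma gameValue_succ {n : ℕ} (B : Finset (Fin n)) (F : List (Message n) → ℝ) (j : ℕ)
    (h : List (Message n)) : gameValue B F (j + 1) h = gameValue B (gameValue B F 1) j h := by
  induction j generalizing h with
  | zero => rfl
  | succ j ih =>
    rw [gameValue]
    simp only [ih]
    rfl

lemma gameValue_empty {n : ℕ} (F : List (Message n) → ℝ) (j : ℕ) (h : List (Message n)) :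
    gameValue ∅ F j h = 𝔼 t : Fin j → Message n, F (h ++ List.ofFn t) := by
  induction j generalizing h with
  | zero => simp [gameValue]
  | succ j ih =>
    rw [expect_fin_cons]
    simp [gameValue, boost_empty, ih, List.ofFn_succ]

/-! ### Optimal strategies -/

/-- Extend the bits of the good players by `false` on the bad players. -/
def extendGood {n : ℕ} {B : Finset (Fin n)} (g : GoodBits B) : Message n :=
  fun j => if hj : j ∈ B then false else g ⟨j, hj⟩

lemma expect_eq_expect_goodBits {n : ℕ} (B : Finset (Fin n)) (H : Message n → ℝ)
    (hH : ∀ x y, (∀ j, j ∉ B → x j = y j) → H x = H y) :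
    𝔼 x, H x = 𝔼 g : GoodBits B, H (extendGood g) := by
  have h1 : 𝔼 x, H x = 𝔼 z : BadBits B × GoodBits B, H (extendGood z.2) := by
    refine Fintype.expect_equiv (Equiv.piEquivPiSubtypeProd (fun j => j ∈ B) fun _ => Bool) _ _
      fun x => hH _ _ fun j hj => ?_
    simp [extendGood, hj]
  rw [h1, ← univ_product_univ, expect_product' univ univ fun _ g => H (extendGood g),
    Fintype.expect_const]

lemma boost_congr_of_agree {n : ℕ} (B : Finset (Fin n)) (F : Message n → ℝ) {x y : Message n}
    (h : ∀ j, j ∉ B → x j = y j) : boost B F x = boost B F y := by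
  have : reachable B x = reachable B y := by
    ext z
    simp only [mem_reachable]
    exact forall₂_congr fun j hj => by rw [h j hj]
  simp only [boost, this]

/-- Some strategy of `B` attains the value of the game. -/
lemma exists_strategy_eq_gameValue {n : ℕ} (B : Finset (Fin n)) (F : List (Message n) → ℝ) (k : ℕ) :
    ∃ σ : Strategy B, ∀ j (h : List (Message n)), j + h.length = k →
      𝔼 x : Fin j → GoodBits B, F (h ++ List.ofFn (play σ j h x)) = gameValue B F j h := by
  choose best hbest hval using fun (h : List (Message n)) (g : GoodBits B) =>
    exists_boost_eq B (fun y => gameValue B F (k - 1 - h.length) (h ++ [y])) (extendGood g)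
  refine ⟨fun h g j => best h g j, fun j => ?_⟩
  set σ : Strategy B := fun h g j => best h g j with hσ
  have hround : ∀ h g, roundMessage σ h g = best h g := by
    intro h g
    ext j
    by_cases hj : j ∈ B
    · simp [roundMessage, hj, hσ]
    · rw [mem_reachable.1 (hbest h g) j hj]
      simp [roundMessage, extendGood, hj]
  induction j with
  | zero => intro h _; simp [gameValue]
  | succ j ih =>
    intro h hk
    rw [expect_fin_cons, gameValue,
      expect_eq_expect_goodBits B _ fun x y hxy => boost_congr_of_agree B _ hxy]
    refine expect_congr rfl fun g _ => ?_
    have hj : k - 1 - h.length = j := by omega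
    have hv := hval h g
    rw [hj] at hv
    rw [hv, ← ih (h ++ [best h g]) (by simp; omega)]
    refine expect_congr rfl fun y _ => ?_
    simp [play, hround, List.ofFn_succ]

/-- The output of a protocol as a payoff. -/
noncomputable def payoff {k n : ℕ} (π : Protocol k n) (h : List (Message n)) : ℝ :=
  if π (fun i => h.getD i fun _ => false) then 1 else 0

lemma payoff_ofFn {k n : ℕ} (π : Protocol k n) (t : Fin k → Message n) :
    payoff π (List.ofFn t) = if π t then 1 else 0 := by
  have : (fun i : Fin k => (List.ofFn t).getD i fun _ => false) = t := by
    funext i; simp [List.getD]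
  rw [payoff, this]

lemma prOne_eq_expect {Ω : Type*} [Fintype Ω] (f : Ω → Bool) :
    prOne f = 𝔼 ω, if f ω then (1 : ℝ) else 0 := by
  rw [prOne, Fintype.expect_eq_sum_div_card, sum_boole]

lemma prOne_eq_gameValue {k n : ℕ} (π : Protocol k n) :
    prOne π = gameValue ∅ (payoff π) k [] := by
  rw [prOne_eq_expect, gameValue_empty]
  exact expect_congr rfl fun t _ => (payoff_ofFn π t).symm

lemma canBias_of_le_gameValue {k n : ℕ} (π : Protocol k n) {B : Finset (Fin n)} {p : ℝ}
    (h : p ≤ gameValue B (payoff π) k []) : CanBias π B p := by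
  obtain ⟨σ, hσ⟩ := exists_strategy_eq_gameValue B (payoff π) k
  refine ⟨σ, h.trans (le_of_eq ?_)⟩
  rw [← hσ k [] (by simp), prOneAgainst, prOne_eq_expect]
  exact expect_congr rfl fun x _ => payoff_ofFn π _

/-! ### Removing the last round -/

/-- The players are divided into `N` blocks by their residues modulo `N`; a union of blocks is not
much larger than its share of the players. -/
lemma card_filter_mod_mem_le (n N : ℕ) (J : Finset ℕ) :
    #(univ.filter fun v : Fin n => (v : ℕ) % N ∈ J) ≤ (n / N + 1) * #J := by
  refine card_le_mul_card_image_of_maps_to (f := fun v : Fin n => (v : ℕ) % N)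
    (fun v hv => (mem_filter.1 hv).2) _ fun b _ => ?_
  rw [← card_range (n / N + 1)]
  refine card_le_card_of_injOn (fun v : Fin n => (v : ℕ) / N) (fun v _ => ?_) ?_
  · simpa [Nat.lt_succ_iff] using Nat.div_le_div_right v.2.le
  · intro v hv w hw hvw
    simp only [coe_filter, mem_filter, Set.mem_ofPred_eq] at hv hw
    refine Fin.ext ?_
    rw [← Nat.div_add_mod (v : ℕ) N, ← Nat.div_add_mod (w : ℕ) N, hv.2, hw.2]
    simp only at hvw
    rw [hvw]

/-- Finitely many small sets are captured, up to a factor `2⁻ᴺ` of their number, by one set that is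
a union of few of the `N` residue blocks. -/
lemma exists_common_superset {A : Type*} {n : ℕ} (s : Finset A) (hs : s.Nonempty)
    (S : A → Finset (Fin n)) {b : ℝ}
    (hS : ∀ a ∈ s, (#(S a) : ℝ) ≤ b) {N : ℕ} (hN : 0 < N) :
    ∃ R : Finset (Fin n), (#R : ℝ) ≤ b * (n / N + 1) ∧
      (#s : ℝ) / 2 ^ N ≤ #(s.filter fun a => S a ⊆ R) := by
  classical
  let J : A → Finset ℕ := fun a => (S a).image fun v : Fin n => (v : ℕ) % N
  obtain ⟨T, -, hT⟩ := exists_le_card_fiber_of_nsmul_le_card_of_maps_to (s := s)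
    (t := (range N).powerset) (f := J) (b := (#s : ℝ) / 2 ^ N)
    (fun a _ => mem_powerset.2 fun v hv => by
      obtain ⟨w, -, rfl⟩ := mem_image.1 hv
      exact mem_range.2 (Nat.mod_lt _ hN))
    ⟨∅, by simp⟩ (by
      rw [card_powerset, card_range, nsmul_eq_mul]
      push_cast
      rw [mul_div_cancel₀ _ (by positivity)])
  have hne : (s.filter fun a => J a = T).Nonempty := by
    rw [← card_pos]
    have : (0 : ℝ) < #s / 2 ^ N := by
      have := card_pos.2 hs
      positivity
    exact_mod_cast this.trans_le hT
  obtain ⟨a, ha⟩ := hne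
  rw [mem_filter] at ha
  refine ⟨univ.filter fun v : Fin n => (v : ℕ) % N ∈ T, ?_, hT.trans ?_⟩
  · have h1 := card_filter_mod_mem_le n N T
    have h2 : (#T : ℝ) ≤ b := by
      rw [← ha.2]
      exact (Nat.cast_le.2 card_image_le).trans (hS a ha.1)
    have h3 : ((n / N : ℕ) : ℝ) ≤ n / N := Nat.cast_div_le
    calc (#(univ.filter fun v : Fin n => (v : ℕ) % N ∈ T) : ℝ)
        ≤ ((n / N : ℕ) + 1) * #T := by exact_mod_cast h1
      _ ≤ (n / N + 1) * b := by gcongr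
      _ = _ := mul_comm _ _
  · refine Nat.cast_le.2 (card_le_card fun a ha => ?_)
    rw [mem_filter] at ha ⊢
    refine ⟨ha.1, fun v hv => mem_filter.2 ⟨mem_univ v, ?_⟩⟩
    rw [← ha.2]
    exact mem_image_of_mem _ hv

lemma expect_le_add_card_div {Ω : Type*} [Fintype Ω] [Nonempty Ω] (G : Ω → ℝ) (hG : ∀ t, G t ≤ 1)
    {c : ℝ} (hc : 0 ≤ c) [DecidablePred fun t => c ≤ G t] :
    𝔼 t, G t ≤ c + #(univ.filter fun t => c ≤ G t) / Fintype.card Ω := by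
  have h : ∀ t, G t ≤ c + if c ≤ G t then 1 else 0 := by
    intro t
    split_ifs with h
    · linarith [hG t]
    · linarith
  calc 𝔼 t, G t ≤ 𝔼 t, (c + if c ≤ G t then 1 else 0) := expect_le_expect fun t _ => h t
    _ = _ := by
      rw [expect_add_distrib, Fintype.expect_const, Fintype.expect_eq_sum_div_card _, sum_boole]

/-- The reduction of `k + 1` rounds to `k` rounds: after the coalition `C` is corrupted, it remains
to bias the `k`-round protocol `g` that tells whether `C` can already bias the last round. -/
theorem exists_reduction {n k : ℕ} (hn : 0 < n) (F : List (Message n) → ℝ)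
    (hF : ∀ h, F h = 0 ∨ F h = 1) {p : ℝ} (hp : 0 < p) (hp1 : p ≤ 1)
    (hE : p ≤ gameValue ∅ F (k + 1) []) {m N : ℕ} (hm : 1 ≤ m) (hN : 0 < N) :
    ∃ (C : Finset (Fin n)) (g : List (Message n) → ℝ), (∀ h, g h = 0 ∨ g h = 1) ∧
      (#C : ℝ) ≤ 8 * Real.log (2 / p) * n / m + 2 * Real.log (2 / p) * 36 ^ m * (n / N + 1) ∧
      p / 4 / 2 ^ N ≤ gameValue ∅ g k [] ∧
      ∀ D, (1 - p / 2) * gameValue D g k [] ≤ gameValue (C ∪ D) F (k + 1) [] := by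
  classical
  let G : (Fin k → Message n) → ℝ := fun t => gameValue ∅ F 1 (List.ofFn t)
  have hG : ∀ t, G t = 𝔼 x, F (List.ofFn t ++ [x]) := fun t => by
    simp [G, gameValue, boost_empty]
  have hG1 : ∀ t, G t ≤ 1 := fun t => by
    rw [hG]; exact expect_le_one_of_zero_or_one fun x => hF _
  let A := {t : Fin k → Message n // p / 2 ≤ G t}
  have hEG : p ≤ 𝔼 t, G t := by
    rw [gameValue_succ, gameValue_empty] at hE
    simpa [G] using hE
  set M := (Fintype.card (Fin k → Message n) : ℝ) with hM
  have hM0 : 0 < M := by rw [hM]; exact Nat.cast_pos.2 Fintype.card_pos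
  have hA : p / 2 * M ≤ Fintype.card A := by
    have h := hEG.trans (expect_le_add_card_div G hG1 (show 0 ≤ p / 2 by linarith))
    rw [← Fintype.card_subtype] at h
    have h2 : p / 2 ≤ (Fintype.card A : ℝ) / M := by linarith
    rwa [le_div_iff₀ hM0] at h2
  have hA0 : (0 : ℝ) < Fintype.card A := lt_of_lt_of_le (by positivity) hA
  have : Nonempty A := Fintype.card_pos_iff.1 (by exact_mod_cast hA0)
  obtain ⟨B, S, hB, hS, hhalf⟩ := exists_common_and_individual_coalitions hn
    (fun (a : A) x => F (List.ofFn a.1 ++ [x])) (fun a x => hF _) (half_pos hp)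
    (fun a => (hG a.1) ▸ a.2) hm
  have hlog : -Real.log (p / 2) = Real.log (2 / p) := by rw [← Real.log_inv, inv_div]
  rw [hlog] at hB
  simp only [hlog] at hS
  set good := univ.filter fun a : A =>
    1 - p / 2 ≤ 𝔼 x, boost (B ∪ S a) (fun x => F (List.ofFn a.1 ++ [x])) x with hgood
  have hgood0 : good.Nonempty := by
    rw [← card_pos]
    have : (0 : ℝ) < #good := by linarith
    exact_mod_cast this
  obtain ⟨R, hR, hRcard⟩ := exists_common_superset good hgood0 S (fun a _ => hS a) hN
  let g : List (Message n) → ℝ := fun h => if 1 - p / 2 ≤ gameValue (B ∪ R) F 1 h then 1 else 0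
  refine ⟨B ∪ R, g, fun h => ?_, ?_, ?_, fun D => ?_⟩
  · simp only [g]; split_ifs <;> simp
  · have : (#(B ∪ R) : ℝ) ≤ #B + #R := by exact_mod_cast card_union_le B R
    linarith
  · have h1 : #(good.filter fun a => S a ⊆ R) ≤
        #(univ.filter fun t : Fin k → Message n =>
          1 - p / 2 ≤ gameValue (B ∪ R) F 1 (List.ofFn t)) := by
      refine card_le_card_of_injOn Subtype.val (fun a ha => ?_) Subtype.val_injective.injOn
      simp only [hgood, coe_filter, mem_filter, Set.mem_ofPred_eq, mem_univ, true_and] at ha ⊢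
      exact ha.1.trans (expect_le_expect fun x _ =>
        boost_mono_left (union_subset_union_right ha.2) _ x)
    rw [gameValue_empty, Fintype.expect_eq_sum_div_card]
    simp only [g, List.nil_append, sum_boole]
    rw [le_div_iff₀ hM0]
    have h2 : (#(good.filter fun a => S a ⊆ R) : ℝ) ≤
        #(univ.filter fun t : Fin k → Message n =>
          1 - p / 2 ≤ gameValue (B ∪ R) F 1 (List.ofFn t)) := by exact_mod_cast h1
    refine le_trans ?_ (hRcard.trans h2)
    rw [div_mul_eq_mul_div]
    gcongr
    linarith
  · have hp2 : 0 ≤ 1 - p / 2 := by linarith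
    rw [gameValue_succ, ← gameValue_const_mul D g hp2]
    refine gameValue_mono subset_union_right (fun h => ?_) k []
    simp only [g]
    split_ifs with hh
    · rw [mul_one]
      exact hh.trans (gameValue_mono subset_union_left (fun _ => le_rfl) 1 h)
    · rw [mul_zero]
      refine expect_nonneg fun x _ => le_trans ?_ (le_boost _ (self_mem_reachable _ x))
      rcases hF (h ++ [x]) with h' | h' <;> simp [gameValue, h']

/-! ### Iterated logarithms -/

lemma iterLog_succ (k : ℕ) (x : ℝ) : iterLog (k + 1) x = Real.logb 2 (iterLog k x) :=
  Function.iterate_succ_apply' _ _ _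

lemma iterLog_eq_two_rpow {k : ℕ} {x : ℝ} (h : 0 < iterLog k x) :
    iterLog k x = 2 ^ iterLog (k + 1) x := by
  rw [iterLog_succ, Real.rpow_logb (by norm_num) (by norm_num) h]

lemma self_le_two_rpow {y : ℝ} (hy : 0 ≤ y) : y ≤ 2 ^ y := by
  by_cases h : 1 ≤ y
  · have := one_add_mul_self_le_rpow_one_add (show (-1 : ℝ) ≤ 1 by norm_num) h
    norm_num at this
    linarith
  · exact (not_le.1 h).le.trans (Real.one_le_rpow (by norm_num) hy)

lemma iterLog_le_self {k : ℕ} {x : ℝ} (h : ∀ j ≤ k, 0 < iterLog j x) : iterLog k x ≤ x := by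
  induction k with
  | zero => exact le_rfl
  | succ k ih =>
    refine le_trans ?_ (ih fun j hj => h j (by omega))
    rw [iterLog_eq_two_rpow (h k (by omega))]
    exact self_le_two_rpow (h (k + 1) le_rfl).le

lemma sq_le_two_rpow_div_four {L : ℝ} (hL : 100 ≤ L) : L ^ 2 ≤ 6 * 2 ^ (L / 4) := by
  have hz : 0.17 * L ≤ Real.log 2 * (L / 4) := by
    have := Real.log_two_gt_d9
    nlinarith
  have h1 : (0.17 * L) ^ 4 / (Nat.factorial 4 : ℕ) ≤ 2 ^ (L / 4) := by
    rw [Real.rpow_def_of_pos (by norm_num)]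
    exact (Real.pow_div_factorial_le_exp _ (by positivity) 4).trans (Real.exp_le_exp.2 hz)
  have h2 : ((Nat.factorial 4 : ℕ) : ℝ) = 24 := by norm_num [Nat.factorial]
  rw [h2] at h1
  have h3 : L ^ 2 ≤ 6 * ((0.17 * L) ^ 4 / 24) := by
    have h4 : 10000 * L ^ 2 ≤ L ^ 2 * L ^ 2 := by gcongr; nlinarith
    calc L ^ 2 ≤ 6 * (0.17 ^ 4 / 24) * (10000 * L ^ 2) := by nlinarith [sq_nonneg L]
      _ ≤ 6 * (0.17 ^ 4 / 24) * (L ^ 2 * L ^ 2) := by gcongr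
      _ = _ := by ring
  linarith

/-- The choice of the parameters `m` and `N` of the reduction from a round at which the iterated
logarithm is `L` to a round at which it is `2 ^ L`. -/
lemma exists_parameters {L T : ℝ} (hL : 100 ≤ L) (hT : 1 ≤ T) (hTL : T ≤ √L) :
    ∃ m N : ℕ, 1 ≤ m ∧ 0 < N ∧ L / 48 ≤ m ∧ 2 * T * 36 ^ m * m ≤ N ∧
      T + 2 + N ≤ √(2 ^ L) ∧ 2 * L ≤ √(2 ^ L) := by
  set y : ℝ := 2 ^ (L / 4) with hy
  have hsq : √((2 : ℝ) ^ L) = y ^ 2 := by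
    rw [hy, ← Real.rpow_natCast, ← Real.rpow_mul (by norm_num), Real.sqrt_eq_rpow,
      ← Real.rpow_mul (by norm_num)]
    congr 1; push_cast; ring
  have hLy : L ^ 2 ≤ 6 * y := sq_le_two_rpow_div_four hL
  have hTL' : T ≤ L := hTL.trans (Real.sqrt_le_iff.2 ⟨by linarith, by nlinarith⟩)
  set m := ⌊L / 24⌋₊ with hm
  have hm_le : (m : ℝ) ≤ L / 24 := Nat.floor_le (by linarith)
  have hm_lt : L / 24 < m + 1 := Nat.lt_floor_add_one _
  have hm1 : 1 ≤ m := Nat.le_floor (by norm_num; linarith)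
  have hpow : (36 : ℝ) ^ m ≤ y := by
    calc (36 : ℝ) ^ m ≤ 64 ^ m := by gcongr; norm_num
      _ = 2 ^ (6 * (m : ℝ)) := by
        rw [Real.rpow_mul (by norm_num), Real.rpow_natCast]; norm_num
      _ ≤ y := Real.rpow_le_rpow_of_exponent_le (by norm_num) (by linarith)
  have hm1' : (1 : ℝ) ≤ m := by exact_mod_cast hm1
  have hN := Nat.ceil_lt_add_one (show 0 ≤ 2 * T * 36 ^ m * m by positivity)
  have hprod : 2 * T * 36 ^ m * m ≤ y ^ 2 / 2 := by
    calc 2 * T * 36 ^ m * m ≤ 2 * L * y * (L / 24) := by gcongr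
      _ = L ^ 2 * y / 12 := by ring
      _ ≤ 6 * y * y / 12 := by gcongr
      _ = _ := by ring
  have hyL : 16 * L ≤ y := by nlinarith
  have hy2 : 16 * L ≤ y ^ 2 / 100 := by nlinarith
  refine ⟨m, ⌈2 * T * 36 ^ m * m⌉₊, hm1, Nat.ceil_pos.2 (by positivity), by linarith,
    Nat.le_ceil _, ?_, ?_⟩
  · rw [hsq]; linarith
  · rw [hsq]; linarith

/-! ### Induction on the number of rounds -/

/-- The bound for initial probabilities `p` that may be as small as `exp (-√(log⁽ᵏ⁾ n))`: the
reduction to fewer rounds produces such probabilities, and the much larger iterated logarithm of the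
earlier round pays for them. -/
theorem exists_coalition_of_log_le (k : ℕ) {n : ℕ} (hn : 0 < n)
    (hpos : ∀ j ≤ k, 0 < iterLog j (n : ℝ)) (hL : 100 ≤ iterLog k (n : ℝ))
    (F : List (Message n) → ℝ) (hF : ∀ h, F h = 0 ∨ F h = 1) {p : ℝ} (hp : 0 < p) (hp1 : p ≤ 1)
    (hT : 1 ≤ Real.log (2 / p)) (hTL : Real.log (2 / p) ≤ √(iterLog k (n : ℝ)))
    (hE : p ≤ gameValue ∅ F k []) :
    ∃ B : Finset (Fin n), (#B : ℝ) ≤ 960 * n * Real.log (2 / p) / iterLog k (n : ℝ) ∧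
      1 - p ≤ gameValue B F k [] := by
  induction k generalizing F p with
  | zero =>
    have hF1 : F [] = 1 := (hF []).resolve_left fun h => by
      rw [gameValue, h] at hE; linarith
    refine ⟨∅, ?_, ?_⟩
    · rw [card_empty, Nat.cast_zero]; positivity
    · rw [gameValue, hF1]; linarith
  | succ k ih =>
    set L := iterLog (k + 1) (n : ℝ) with hLdef
    set T := Real.log (2 / p) with hTdef
    have hL' : iterLog k (n : ℝ) = 2 ^ L := iterLog_eq_two_rpow (hpos k (by omega))
    have hLL' : L ≤ 2 ^ L := self_le_two_rpow (by linarith)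
    have hn0 : (0 : ℝ) < n := by exact_mod_cast hn
    obtain ⟨m, N, hm, hN, hmL, hNm, hNL, hL2⟩ := exists_parameters hL hT hTL
    have hm0 : (0 : ℝ) < m := by exact_mod_cast hm
    have hN0 : (0 : ℝ) < N := by exact_mod_cast hN
    have h2L1 : (1 : ℝ) ≤ 2 ^ L := by linarith
    have hNn : (N : ℝ) ≤ n := by
      have h1 : iterLog k (n : ℝ) ≤ n := iterLog_le_self fun j hj => hpos j (by omega)
      have h2 : √((2 : ℝ) ^ L) ≤ 2 ^ L := Real.sqrt_le_iff.2 ⟨by linarith, by nlinarith⟩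
      linarith
    obtain ⟨C, g, hg, hC, hgE, hstep⟩ := exists_reduction hn F hF hp hp1 hE hm hN
    rw [← hTdef] at hC
    set p' := p / 4 / 2 ^ N with hp'
    have hp'0 : 0 < p' := by positivity
    have hp'p : p' ≤ p / 4 := div_le_self (by positivity) (one_le_pow₀ (by norm_num))
    have hT' : Real.log (2 / p') = T + Real.log 4 + N * Real.log 2 := by
      rw [hp', hTdef, show 2 / (p / 4 / 2 ^ N) = 2 / p * 4 * 2 ^ N by field_simp,
        Real.log_mul (by positivity) (by positivity), Real.log_mul (by positivity) (by positivity),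
        Real.log_pow]
    have hlog2 : 0 ≤ Real.log 2 := Real.log_nonneg (by norm_num)
    have hlog2' : Real.log 2 ≤ 1 := by linarith [Real.log_two_lt_d9]
    have hlog4 : Real.log 4 = 2 * Real.log 2 := by
      rw [show (4 : ℝ) = 2 ^ 2 by norm_num, Real.log_pow]; norm_num
    have hT'lo : T ≤ Real.log (2 / p') := by
      have : 0 ≤ N * Real.log 2 := by positivity
      linarith
    have hT'hi : Real.log (2 / p') ≤ √(2 ^ L) := by
      have : N * Real.log 2 ≤ N := mul_le_of_le_one_right hN0.le hlog2'
      linarith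
    obtain ⟨D, hD, hDE⟩ := ih (fun j hj => hpos j (by omega)) (by rw [hL']; linarith) g hg hp'0
      (by linarith) (hT.trans hT'lo) (by rwa [hL']) hgE
    refine ⟨C ∪ D, ?_, ?_⟩
    · have hL0 : 0 < L := by linarith
      have h1 : 8 * T * n / m ≤ 384 * (n * T / L) := by
        rw [div_le_iff₀ hm0]
        have : 1 ≤ 48 * m / L := by rw [le_div_iff₀ hL0]; linarith
        calc 8 * T * n = 8 * T * n * 1 := by ring
          _ ≤ 8 * T * n * (48 * m / L) := by gcongr
          _ = _ := by ring
      have h2 : 2 * T * 36 ^ m * (n / N + 1) ≤ 96 * (n * T / L) := by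
        have h3 : (n : ℝ) / N + 1 ≤ 2 * (n / N) := by
          have : 1 ≤ (n : ℝ) / N := (one_le_div hN0).2 hNn
          linarith
        have h4 : 1 / (m : ℝ) ≤ 48 / L := by rw [div_le_div_iff₀ hm0 hL0]; linarith
        calc 2 * T * 36 ^ m * (n / N + 1) ≤ 2 * T * 36 ^ m * (2 * (n / N)) := by gcongr
          _ = (2 * T * 36 ^ m * m) / N * (2 * n * (1 / m)) := by field_simp
          _ ≤ 1 * (2 * n * (48 / L)) := by
            gcongr
            exact (div_le_one hN0).2 hNm
          _ = 96 * (n * 1 / L) := by ring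
          _ ≤ _ := by gcongr
      have h5 : 960 * n * Real.log (2 / p') / iterLog k (n : ℝ) ≤ 480 * (n * T / L) := by
        rw [hL']
        have hs0 : 0 < √((2 : ℝ) ^ L) := by linarith
        calc 960 * n * Real.log (2 / p') / 2 ^ L ≤ 960 * n * √(2 ^ L) / 2 ^ L := by gcongr
          _ = 960 * n * √(2 ^ L) / (√(2 ^ L) * √(2 ^ L)) := by
            rw [Real.mul_self_sqrt (by positivity)]
          _ = 960 * n / √(2 ^ L) := by field_simp
          _ ≤ 960 * n / (2 * L) := by gcongr
          _ = 480 * (n * 1 / L) := by field_simp; norm_num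
          _ ≤ _ := by gcongr
      have h6 : (#(C ∪ D) : ℝ) ≤ #C + #D := by exact_mod_cast card_union_le C D
      calc (#(C ∪ D) : ℝ) ≤ 960 * (n * T / L) := by linarith
        _ = _ := by ring
    · refine le_trans ?_ (hstep D)
      have h1 : (1 - p / 2) * (1 - p') ≤ (1 - p / 2) * gameValue D g k [] :=
        mul_le_mul_of_nonneg_left hDE (by linarith)
      nlinarith

lemma le_gameValue_univ {n : ℕ} (F : List (Message n) → ℝ) (k : ℕ) (h : List (Message n))
    (t : Fin k → Message n) : F (h ++ List.ofFn t) ≤ gameValue univ F k h := by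
  induction k generalizing h with
  | zero => simp [gameValue]
  | succ k ih =>
    rw [gameValue]
    refine le_expect univ_nonempty fun x _ => ?_
    refine le_trans ?_ (le_boost _ (y := t 0)
      (mem_reachable.2 fun j hj => absurd (mem_univ j) hj))
    simpa [List.ofFn_succ] using ih (h ++ [t 0]) fun i => t i.succ

lemma one_le_gameValue_univ {k n : ℕ} (π : Protocol k n) (h : 0 < prOne π) :
    1 ≤ gameValue univ (payoff π) k [] := by
  obtain ⟨t, ht⟩ : ∃ t, π t = true := by
    by_contra! hne
    simp [prOne, hne] at h
  have := le_gameValue_univ (payoff π) k [] t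
  rwa [List.nil_append, payoff_ofFn, if_pos ht] at this

end CoinFlip

/-- There is an absolute constant `C`, independent of the number `k` of rounds, the number `ℓ` of
players and the protocol. The hypothesis on `iterLog` says that the `k`-fold iterated logarithm of
`ℓ` is defined (every logarithm is taken of a positive number) and positive. -/
theorem mainTheorem1 :
    ∃ C : ℝ, 0 < C ∧
      ∀ (k ℓ : ℕ), 1 ≤ k →
        (∀ j : ℕ, j ≤ k → 0 < CoinFlip.iterLog j (ℓ : ℝ)) →
        ∀ π : CoinFlip.Protocol k ℓ,
          (1 / 100 : ℝ) ≤ CoinFlip.prOne π →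
          ∃ B : Finset (Fin ℓ),
            (B.card : ℝ) ≤ C * ((ℓ : ℝ) / CoinFlip.iterLog k (ℓ : ℝ)) ∧
            CoinFlip.CanBias π B (99 / 100 : ℝ) := by
  refine ⟨9600, by norm_num, fun k ℓ _ hpos π hπ => ?_⟩
  have hL0 := hpos k le_rfl
  have hℓ : (0 : ℝ) < ℓ := hpos 0 (Nat.zero_le k)
  by_cases hL : 100 ≤ CoinFlip.iterLog k (ℓ : ℝ)
  · have hlog : Real.log (2 / (1 / 100)) ≤ 10 := by
      rw [Real.log_le_iff_le_exp (by norm_num)]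
      have := Real.pow_div_factorial_le_exp 10 (by norm_num) 4
      norm_num [Nat.factorial] at this ⊢
      linarith
    have hlog1 : 1 ≤ Real.log (2 / (1 / 100)) := by
      rw [Real.le_log_iff_exp_le (by norm_num)]
      have := Real.exp_one_lt_d9
      norm_num at this ⊢
      linarith
    have hsqrt : 10 ≤ √(CoinFlip.iterLog k (ℓ : ℝ)) := Real.le_sqrt_of_sq_le (by linarith)
    rw [CoinFlip.prOne_eq_gameValue] at hπ
    obtain ⟨B, hB, hBv⟩ := CoinFlip.exists_coalition_of_log_le k (by exact_mod_cast hℓ) hpos hL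
      (CoinFlip.payoff π) (fun h => by unfold CoinFlip.payoff; split_ifs <;> simp) (by norm_num)
      (by norm_num) hlog1 (hlog.trans hsqrt) hπ
    refine ⟨B, hB.trans ?_, CoinFlip.canBias_of_le_gameValue π (le_trans (by norm_num) hBv)⟩
    calc 960 * (ℓ : ℝ) * Real.log (2 / (1 / 100)) / CoinFlip.iterLog k (ℓ : ℝ)
        ≤ 960 * (ℓ : ℝ) * 10 / CoinFlip.iterLog k (ℓ : ℝ) := by gcongr
      _ = _ := by ring
  · -- If the iterated logarithm is bounded, all players may be corrupted.
    refine ⟨Finset.univ, ?_, CoinFlip.canBias_of_le_gameValue π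
      (le_trans (by norm_num) (CoinFlip.one_le_gameValue_univ π (by linarith)))⟩
    rw [Finset.card_univ, Fintype.card_fin, ← mul_div_assoc, le_div_iff₀ hL0]
    nlinarith
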